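/- Let $X$ be a metric space. A map $\mu : X^3 \to X$ is a *coarse median* if there is a constant $\kappa \ge 0$ such that - (C0) $d(\mu(a_1,a_1,a_2),a_1) \le \kappa$ and $d(\mu(a_{\sigma(1)},a_{\sigma(2)},a_{\sigma(3)}),\mu(a_1,a_2,a_3)) \le \kappa$ for all $a_1,a_2,a_3 \in X$ and every permutation $\sigma$ of $\{1,2,3\}$; - (C1) $d(\mu(a,b,c),\mu(a',b,c)) \le \kappa\, d(a,a') + \kappa$ for all $a,a',b,c \in X$; - (C2) $d(\mu(\mu(a,b,c),b,d),\mu(a,b,\mu(c,b,d))) \le \kappa$ for all $a,b,c,d \in X$. A finitely generated group is *coarse median* if it admits a coarse median when it is endowed with the word metric of some finite generating set (equivalently, of any finite generating set). Given a simplicial graph $\Gamma$ (no loops, no multiple edges) and a collection $\mathcal{G} = \{G_u \mid u \in V(\Gamma)\}$ of groups, the *graph product* $\Gamma\mathcal{G}$ is the quotient of the free product $\ast_{u \in V(\Gamma)} G_u$ by the normal closure of the commutators $[g,h]$ with $g \in G_u$, $h \in G_v$ and $\{u,v\} \in E(\Gamma)$. **Theorem 7.4.** Let $\Gamma$ be a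 finite simplicial graph and $\mathcal{G}$ a collection of finitely generated groups indexed by $V(\Gamma)$. If the groups in $\mathcal{G}$ are coarse median, then so is the graph product $\Gamma\mathcal{G}$ (in particular, it is finitely generated). -/

import Mathlib

open scoped commutatorElement

/-- The graph product of the groups `G u` (`u` a vertex of `Γ`): the quotient of the free product of
the `G u` by the normal closure of the commutators `⁅g, h⁆`, where `g ∈ G u`, `h ∈ G v` and `u`, `v`
are adjacent in `Γ`. -/
def GraphProduct {V : Type*} (Γ : SimpleGraph V) (G : V → Type*) [∀ u, Group (G u)] : Type _ :=
  Monoid.CoprodI G ⧸ Subgroup.normalClosure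
    {x : Monoid.CoprodI G | ∃ u v : V, Γ.Adj u v ∧ ∃ (g : G u) (h : G v),
      x = ⁅(Monoid.CoprodI.of g : Monoid.CoprodI G), (Monoid.CoprodI.of h : Monoid.CoprodI G)⁆}

instance GraphProduct.instGroup {V : Type*} (Γ : SimpleGraph V) (G : V → Type*)
    [∀ u, Group (G u)] : Group (GraphProduct Γ G) :=
  inferInstanceAs (Group (Monoid.CoprodI G ⧸ Subgroup.normalClosure
    {x : Monoid.CoprodI G | ∃ u v : V, Γ.Adj u v ∧ ∃ (g : G u) (h : G v),
      x = ⁅(Monoid.CoprodI.of g : Monoid.CoprodI G), (Monoid.CoprodI.of h : Monoid.CoprodI G)⁆}))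

/-- `IsWordOver S l` : every letter of the word `l` is an element of `S` or an inverse of one. -/
def IsWordOver {G : Type*} [Group G] (S : Set G) (l : List G) : Prop :=
  ∀ x ∈ l, x ∈ S ∨ x⁻¹ ∈ S

/-- The word length of `g` with respect to `S`: the least length of a word in the letters
`S ∪ S⁻¹` that represents `g`. It is used only when `S` generates the group. -/
noncomputable def wordLength {G : Type*} [Group G] (S : Set G) (g : G) : ℕ :=
  sInf {n : ℕ | ∃ l : List G, IsWordOver S l ∧ l.prod = g ∧ l.length = n}

theorem wordLength_le {G : Type*} [Group G] {S : Set G} {l : List G} (hl : IsWordOver S l) :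
    wordLength S l.prod ≤ l.length :=
  Nat.sInf_le ⟨l, hl, rfl, rfl⟩

theorem exists_word {G : Type*} [Group G] {S : Set G} (hS : Subgroup.closure S = ⊤) (g : G) :
    ∃ l : List G, IsWordOver S l ∧ l.prod = g ∧ l.length = wordLength S g := by
  have hne : {n : ℕ | ∃ l : List G, IsWordOver S l ∧ l.prod = g ∧ l.length = n}.Nonempty := by
    have hg : g ∈ Subgroup.closure S := by rw [hS]; trivial
    rw [← Subgroup.mem_toSubmonoid, Subgroup.closure_toSubmonoid] at hg
    obtain ⟨l, hl, hp⟩ := Submonoid.exists_list_of_mem_closure hg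
    exact ⟨l.length, l, fun x hx => by simpa using hl x hx, hp, rfl⟩
  exact Nat.sInf_mem hne

theorem wordLength_one {G : Type*} [Group G] (S : Set G) : wordLength S 1 = 0 := by
  have h := wordLength_le (S := S) (l := []) (by intro x hx; simp at hx)
  simpa using h

theorem wordLength_mul_le {G : Type*} [Group G] {S : Set G} (hS : Subgroup.closure S = ⊤)
    (g h : G) : wordLength S (g * h) ≤ wordLength S g + wordLength S h := by
  obtain ⟨l, hl, rfl, hn⟩ := exists_word hS g
  obtain ⟨m, hm, rfl, hk⟩ := exists_word hS h
  rw [← hn, ← hk, ← List.prod_append, ← List.length_append]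
  apply wordLength_le
  intro x hx
  rcases List.mem_append.1 hx with hx | hx
  · exact hl x hx
  · exact hm x hx

theorem wordLength_inv_le {G : Type*} [Group G] {S : Set G} (hS : Subgroup.closure S = ⊤)
    (g : G) : wordLength S g⁻¹ ≤ wordLength S g := by
  obtain ⟨l, hl, rfl, hn⟩ := exists_word hS g
  rw [← hn, List.prod_inv_reverse]
  refine (wordLength_le ?_).trans (by simp)
  intro x hx
  simp only [List.mem_reverse, List.mem_map] at hx
  obtain ⟨y, hy, rfl⟩ := hx
  rw [inv_inv]
  exact (hl y hy).symm

theorem eq_one_of_wordLength {G : Type*} [Group G] {S : Set G} (hS : Subgroup.closure S = ⊤)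
    {g : G} (h : wordLength S g = 0) : g = 1 := by
  obtain ⟨l, -, rfl, hn⟩ := exists_word hS g
  rw [h, List.length_eq_zero_iff] at hn
  simp [hn]

/-- The word metric `d(x, y) = |x⁻¹ y|` of a group with respect to a generating set. -/
@[reducible] noncomputable def wordMetric {G : Type*} [Group G] (S : Set G)
    (hS : Subgroup.closure S = ⊤) : MetricSpace G where
  dist x y := (wordLength S (x⁻¹ * y) : ℝ)
  dist_self x := by simp [wordLength_one]
  dist_comm x y := by
    have h1 := wordLength_inv_le hS (x⁻¹ * y)
    have h2 := wordLength_inv_le hS (y⁻¹ * x)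
    simp only [mul_inv_rev, inv_inv] at h1 h2
    exact_mod_cast le_antisymm h2 h1
  dist_triangle x y z := by
    have h := wordLength_mul_le hS (x⁻¹ * y) (y⁻¹ * z)
    have e : x⁻¹ * y * (y⁻¹ * z) = x⁻¹ * z := by group
    rw [e] at h
    exact_mod_cast h
  eq_of_dist_eq_zero {x y} h := by
    have h' : x⁻¹ * y = 1 := eq_one_of_wordLength hS (by exact_mod_cast h)
    exact inv_mul_eq_one.1 h'

/-- The conditions on a ternary operation `μ` for being a coarse median with constant `κ`. -/
structure IsCoarseMedianWith {X : Type*} [MetricSpace X] (μ : X → X → X → X) (κ : ℝ) : Prop where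
  /-- coarse majority vote -/
  majority : ∀ a b : X, dist (μ a a b) a ≤ κ
  /-- coarse symmetry under all permutations of the arguments -/
  symmetric : ∀ (a : Fin 3 → X) (σ : Equiv.Perm (Fin 3)),
    dist (μ (a (σ 0)) (a (σ 1)) (a (σ 2))) (μ (a 0) (a 1) (a 2)) ≤ κ
  /-- affine control in the first argument -/
  coarseLipschitz : ∀ a a' b c : X, dist (μ a b c) (μ a' b c) ≤ κ * dist a a' + κ
  /-- coarse four-point condition -/
  fourPoint : ∀ a b c d : X, dist (μ (μ a b c) b d) (μ a b (μ c b d)) ≤ κ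

/-- A coarse median on a metric space. -/
def IsCoarseMedian {X : Type*} [MetricSpace X] (μ : X → X → X → X) : Prop :=
  ∃ κ : ℝ, 0 ≤ κ ∧ IsCoarseMedianWith μ κ

/-- A coarse median group: a finitely generated group that admits a coarse median with respect to
the word metric of some finite generating set. -/
def IsCoarseMedianGroup (G : Type*) [Group G] : Prop :=
  ∃ (S : Set G) (_ : S.Finite) (hS : Subgroup.closure S = ⊤) (μ : G → G → G → G),
    @IsCoarseMedian G (wordMetric S hS) μ

/-!
The graph product `P` is embedded isometrically into an `ℓ¹` product of copies of the vertex groups,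
and the coarse median is taken coordinatewise.

The coordinates are indexed by the hyperplanes of the Cayley graph of `P` with respect to the union
of the vertex groups, that is, by the classes of parallel cosets of vertex groups. The hyperplanes
of type `u` correspond to the cosets of the subgroup `star u` generated by `G u` and the groups of
its neighbours, and the coordinate of an element is its projection to one of the parallel cosets of
`G u`. This projection comes from the head `GraphProduct.head`, a map `P → G u` that is equivariant
under `star u`. The kernel of the retraction of `P` that kills `G u` is a free product of conjugates
of `G u`, one for each coset of the link of `u` in the retract. Accordingly, `P` maps to the
semidirect product with `P` of a free product of copies of `G u` indexed by the cosets of the link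
in `P`, and this map has a left inverse; the head is the first letter in the free product if it
belongs to the base coset. The property that carries everything else is `GraphProduct.head_mul_of`:
along an edge of the Cayley graph, only the coordinate at the hyperplane of this edge changes.

It follows that the word metric is the `ℓ¹` metric of the coordinates
(`GraphProduct.wordLength_eq_coordDist`), and that two distinct hyperplanes whose types are not
adjacent in `Γ` have distinguished coordinates `a` and `b`, such that every element has coordinate
`a` at the first or `b` at the second one (`GraphProduct.coord_eq_or_coord_eq`). Conversely, these
constraints characterise the families of coordinates of elements of `P`, among the families that
are finitely supported relative to an element (`HyperplaneSystem.exists_coord_eq`).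

The coarse medians of the vertex groups can be changed to be the exact majority vote where two
arguments agree. Then the coordinatewise median of three elements satisfies the constraints, because
two of the three elements have the coordinate `a`, or two have `b`; hence it is the family of
coordinates of an element. The majority condition holds exactly, and the Lipschitz condition sums up
over the coordinates, since points of the vertex groups that differ have distance at least `1`. In
the symmetry and four-point conditions, a coordinate contributes to the error only where three of the
given elements have three distinct coordinates. Such hyperplanes have distinct types, so that there
are at most as many of them as vertices of `Γ` (`HyperplaneSystem.ncard_tripleSet_le`), and the
total error is bounded.
-/

/-! ### Exact majority vote -/

section Majority

variable {A : Type*} {μ : A → A → A → A}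

theorem majority_perm (h : ∀ a b, μ a a b = a ∧ μ a b a = a ∧ μ b a a = a)
    {f : Fin 3 → A} (hf : ¬ (f 0 ≠ f 1 ∧ f 0 ≠ f 2 ∧ f 1 ≠ f 2))
    (σ : Equiv.Perm (Fin 3)) : μ (f (σ 0)) (f (σ 1)) (f (σ 2)) = μ (f 0) (f 1) (f 2) := by
  have hF : ∀ i : Fin 3, i = 0 ∨ i = 1 ∨ i = 2 := by decide
  have h01 : σ 0 ≠ σ 1 := σ.injective.ne (by decide)
  have h02 : σ 0 ≠ σ 2 := σ.injective.ne (by decide)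
  have h12 : σ 1 ≠ σ 2 := σ.injective.ne (by decide)
  rcases hF (σ 0) with h0 | h0 | h0 <;> rcases hF (σ 1) with h1 | h1 | h1 <;>
    rcases hF (σ 2) with h2 | h2 | h2 <;> simp only [h0, h1, h2] at h01 h02 h12 ⊢ <;> grind

/-- The four-point condition holds exactly, unless `a`, `b`, `d` or `b`, `c`, `d` are distinct. -/
theorem majority_fourPoint (h : ∀ a b, μ a a b = a ∧ μ a b a = a ∧ μ b a a = a) {a b c d : A}
    (h1 : ¬ (a ≠ b ∧ a ≠ d ∧ b ≠ d)) (h2 : ¬ (b ≠ c ∧ b ≠ d ∧ c ≠ d)) :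
    μ (μ a b c) b d = μ a b (μ c b d) := by
  grind

end Majority

open Classical in
/-- The modification of a ternary operation that is the majority vote where two arguments agree. -/
noncomputable def exactMajority {X : Type*} (μ : X → X → X → X) (a b c : X) : X :=
  if a = b then a else if a = c then a else if b = c then b else μ a b c

theorem exactMajority_spec {X : Type*} (μ : X → X → X → X) (a b : X) :
    exactMajority μ a a b = a ∧ exactMajority μ a b a = a ∧ exactMajority μ b a a = a := by
  unfold exactMajority
  grind

section ExactMajority

variable {X : Type*} [MetricSpace X] {μ : X → X → X → X} {κ : ℝ}

theorem IsCoarseMedianWith.dist_swap (h : IsCoarseMedianWith μ κ) (a b c : X) :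
    dist (μ c b a) (μ a b c) ≤ κ := by
  simpa [Equiv.swap_apply_of_ne_of_ne] using h.symmetric ![a, b, c] (Equiv.swap 0 2)

theorem IsCoarseMedianWith.dist_exactMajority_le (hκ : 0 ≤ κ) (h : IsCoarseMedianWith μ κ)
    (a b c : X) : dist (exactMajority μ a b c) (μ a b c) ≤ 2 * κ := by
  unfold exactMajority
  split_ifs with h1 h2 h3
  · subst h1
    have := h.majority a c
    rw [dist_comm] at this
    linarith
  · subst h2
    have h4 := h.majority a b
    have h5 := h.symmetric ![a, a, b] (Equiv.swap 1 2)
    have h6 : dist (μ a b a) (μ a a b) ≤ κ := by simpa [Equiv.swap_apply_of_ne_of_ne] using h5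
    have := dist_triangle (μ a b a) (μ a a b) a
    rw [dist_comm]
    linarith
  · subst h3
    have h4 := h.majority b a
    have h6 := h.dist_swap b b a
    have := dist_triangle (μ a b b) (μ b b a) b
    rw [dist_comm]
    linarith
  · rw [dist_self]
    positivity

/-- An operation at bounded distance from a coarse median is a coarse median. -/
theorem IsCoarseMedianWith.of_dist_le {ν : X → X → X → X} {ε : ℝ} (hκ : 0 ≤ κ) (hε : 0 ≤ ε)
    (h : IsCoarseMedianWith μ κ) (hν : ∀ a b c, dist (ν a b c) (μ a b c) ≤ ε) :
    IsCoarseMedianWith ν (2 * κ * ε + 5 * κ + 2 * ε) := by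
  have hp : 0 ≤ κ * ε := by positivity
  have hν' : ∀ a b c, dist (μ a b c) (ν a b c) ≤ ε := fun a b c => by
    rw [dist_comm]; exact hν a b c
  refine ⟨?_, ?_, ?_, ?_⟩
  · intro a b
    have := dist_triangle (ν a a b) (μ a a b) a
    linarith [hν a a b, h.majority a b]
  · intro a σ
    have := dist_triangle4 (ν (a (σ 0)) (a (σ 1)) (a (σ 2))) (μ (a (σ 0)) (a (σ 1)) (a (σ 2)))
      (μ (a 0) (a 1) (a 2)) (ν (a 0) (a 1) (a 2))
    linarith [hν (a (σ 0)) (a (σ 1)) (a (σ 2)), hν' (a 0) (a 1) (a 2), h.symmetric a σ]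
  · intro a a' b c
    have h1 := dist_triangle4 (ν a b c) (μ a b c) (μ a' b c) (ν a' b c)
    have h2 := h.coarseLipschitz a a' b c
    have h3 : 0 ≤ (2 * κ * ε + 4 * κ + 2 * ε) * dist a a' := by positivity
    linarith [hν a b c, hν' a' b c]
  · intro a b c d
    have h1 := dist_triangle4 (ν (ν a b c) b d) (μ (ν a b c) b d) (μ (μ a b c) b d)
      (μ a b (μ c b d))
    have h2 := dist_triangle4 (μ a b (μ c b d)) (μ (μ c b d) b a) (μ (ν c b d) b a)
      (μ a b (ν c b d))
    have h3 := dist_triangle4 (ν (ν a b c) b d) (μ a b (μ c b d)) (μ a b (ν c b d))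
      (ν a b (ν c b d))
    have h4 := h.coarseLipschitz (ν a b c) (μ a b c) b d
    have h5 := h.coarseLipschitz (μ c b d) (ν c b d) b a
    have h6 := mul_le_mul_of_nonneg_left (hν a b c) hκ
    have h7 := mul_le_mul_of_nonneg_left (hν' c b d) hκ
    linarith [hν (ν a b c) b d, hν' a b (ν c b d), h.fourPoint a b c d,
      h.dist_swap (μ c b d) b a, h.dist_swap a b (ν c b d)]

theorem IsCoarseMedianWith.mono {κ' : ℝ} (hκ : κ ≤ κ') (h : IsCoarseMedianWith μ κ) :
    IsCoarseMedianWith μ κ' where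
  majority a b := (h.majority a b).trans hκ
  symmetric a σ := (h.symmetric a σ).trans hκ
  coarseLipschitz a a' b c := (h.coarseLipschitz a a' b c).trans (by gcongr)
  fourPoint a b c d := (h.fourPoint a b c d).trans hκ

/-- A coarse median can be chosen to be the majority vote where two arguments agree. -/
theorem IsCoarseMedian.exists_exactMajority (h : IsCoarseMedian μ) :
    ∃ (ν : X → X → X → X) (κ : ℝ), 0 ≤ κ ∧ IsCoarseMedianWith ν κ ∧
      ∀ a b, ν a a b = a ∧ ν a b a = a ∧ ν b a a = a := by
  obtain ⟨κ, hκ, h⟩ := h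
  exact ⟨exactMajority μ, _, by positivity,
    h.of_dist_le hκ (by positivity) (h.dist_exactMajority_le hκ), exactMajority_spec μ⟩

end ExactMajority

/-! ### Coarse medians on spaces with hyperplane coordinates -/

/-- Coordinates on a metric space `X`, indexed by a set `H` of hyperplanes whose types are in `V`,
such that the metric is the `ℓ¹` metric of the coordinates. A point is adjacent to some of the
hyperplanes; there, the coordinate of this hyperplane can be changed freely while all others are
kept. The other hyperplanes adjacent to the point are still adjacent after such a change, unless
they are constrained by the hyperplane in question: every point shares with the given one its
coordinate at one of the two. -/
structure HyperplaneSystem (X : Type*) [MetricSpace X] (V H : Type*) (M : H → Type*)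
    [∀ J, MetricSpace (M J)] where
  /-- the coordinates of a point -/
  coord : ∀ J, X → M J
  /-- adjacency of a point and a hyperplane -/
  Adj : X → H → Prop
  /-- the type of a hyperplane -/
  type : H → V
  finite_ne : ∀ x y, {J | coord J x ≠ coord J y}.Finite
  dist_eq : ∀ x y, dist x y = ∑ᶠ J, dist (coord J x) (coord J y)
  exists_adj : ∀ J, ∃ x, Adj x J
  exists_adj_ne : ∀ x y, x ≠ y → ∃ J, Adj x J ∧ coord J x ≠ coord J y
  exists_move : ∀ x J, Adj x J → ∀ a : M J, ∃ x', Adj x' J ∧ coord J x' = a ∧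
    (∀ K, K ≠ J → coord K x' = coord K x) ∧
    ∀ K, Adj x K → Adj x' K ∨ J ≠ K ∧ ∀ y, coord J y = coord J x ∨ coord K y = coord K x
  sameType : ∀ J K, J ≠ K → type J = type K →
    ∃ a b, ∀ y, coord J y = a ∨ coord K y = b

namespace HyperplaneSystem

variable {X V H : Type*} [MetricSpace X] {M : H → Type*} [∀ J, MetricSpace (M J)]
  (S : HyperplaneSystem X V H M)

/-- If some coordinate of `m` differs from the prescribed one, then this is so for a hyperplane that
is adjacent to `m`: of the points adjacent to wrong hyperplanes, one that is separated
from `m` by the fewest hyperplanes must be `m` itself. -/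
theorem exists_adj_ne_of_ne {q : ∀ J, M J}
    (hq : ∀ J K a b, J ≠ K → (∀ y, S.coord J y = a ∨ S.coord K y = b) → q J = a ∨ q K = b)
    (m : X) {K : H} (hK : q K ≠ S.coord K m) : ∃ J, S.Adj m J ∧ q J ≠ S.coord J m := by
  have key : ∀ (n : ℕ) (K : H) (k : X), S.Adj k K → q K ≠ S.coord K m →
      {J | S.coord J m ≠ S.coord J k}.ncard = n → ∃ J, S.Adj m J ∧ q J ≠ S.coord J m := by
    intro n
    induction n using Nat.strong_induction_on with
    | _ n ih =>
      intro K k hk hqK hn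
      -- giving `k` the coordinate of `m` at a hyperplane that separates them brings it closer
      have closer : ∀ L k', S.coord L k ≠ S.coord L m → S.coord L k' = S.coord L m →
          (∀ K, K ≠ L → S.coord K k' = S.coord K k) →
          {J | S.coord J m ≠ S.coord J k'}.ncard < n := by
        intro L k' hL hL' hk'
        rw [← hn]
        refine Set.ncard_lt_ncard ?_ (S.finite_ne m k)
        refine ⟨fun J hJ => ?_, fun h => h (show L ∈ _ from hL.symm) hL'.symm⟩
        have hJL : J ≠ L := by
          rintro rfl
          exact hJ hL'.symm
        rw [Set.mem_ofPred_eq, hk' J hJL] at hJ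
        exact hJ
      by_cases hc : S.coord K k = S.coord K m
      · by_cases hmk : k = m
        · exact ⟨K, hmk ▸ hk, hqK⟩
        · obtain ⟨L, hkL, hL⟩ := S.exists_adj_ne k m hmk
          obtain ⟨k', hk'L, hk'm, hk', hsq⟩ := S.exists_move k L hkL (S.coord L m)
          have hlt := closer L k' hL hk'm hk'
          rcases hsq K hk with h | ⟨hLK, h⟩
          · exact ih _ hlt K k' h hqK rfl
          · rcases hq L K _ _ hLK h with h1 | h1
            · exact ih _ hlt L k' hk'L (by rwa [h1]) rfl
            · exact absurd (h1.trans hc) hqK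
      · obtain ⟨k', hk'K, hk'm, hk', -⟩ := S.exists_move k K hk (S.coord K m)
        exact ih _ (closer K k' hc hk'm hk') K k' hk'K hqK rfl
  obtain ⟨k, hk⟩ := S.exists_adj K
  exact key _ K k hk hK rfl

/-- A family of coordinates that is almost equal to the coordinates of a point and satisfies the
constraints between pairs of hyperplanes is the family of coordinates of a point. -/
theorem exists_coord_eq {q : ∀ J, M J}
    (hq : ∀ J K a b, J ≠ K → (∀ y, S.coord J y = a ∨ S.coord K y = b) → q J = a ∨ q K = b)
    (m : X) (hfin : {J | q J ≠ S.coord J m}.Finite) : ∃ x, ∀ J, S.coord J x = q J := by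
  induction hn : {J | q J ≠ S.coord J m}.ncard using Nat.strong_induction_on generalizing m with
  | _ n ih =>
    by_cases h : ∀ J, S.coord J m = q J
    · exact ⟨m, h⟩
    · push Not at h
      obtain ⟨K, hK⟩ := h
      obtain ⟨J, hmJ, hJ⟩ := S.exists_adj_ne_of_ne hq m hK.symm
      obtain ⟨m', -, hJ', hm', -⟩ := S.exists_move m J hmJ (q J)
      have hss : {J | q J ≠ S.coord J m'} ⊂ {J | q J ≠ S.coord J m} := by
        refine ⟨fun L hL => ?_, fun h => h (show J ∈ _ from hJ) hJ'.symm⟩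
        have hLJ : L ≠ J := by
          rintro rfl
          exact hL hJ'.symm
        rw [Set.mem_ofPred_eq, hm' L hLJ] at hL
        exact hL
      exact ih _ (hn ▸ Set.ncard_lt_ncard hss hfin) m' (hfin.subset hss.1) rfl

section Dist

theorem finite_support (x y : X) :
    (Function.support fun J => dist (S.coord J x) (S.coord J y)).Finite :=
  (S.finite_ne x y).subset fun _ hJ h => hJ (by simp [h])

/-- If the coordinates of two points differ at most at a finite set of hyperplanes, and there by at
most `κ`, then so does the distance, up to the number of these hyperplanes. -/
theorem dist_le_ncard_mul {x y : X} {κ : ℝ} {W : Set H} (hW : W.Finite)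
    (hd : ∀ J, dist (S.coord J x) (S.coord J y) ≤ κ)
    (h : ∀ J, J ∉ W → S.coord J x = S.coord J y) : dist x y ≤ W.ncard * κ := by
  rw [S.dist_eq, finsum_eq_sum_of_support_subset (s := hW.toFinset),
    Set.ncard_eq_toFinset_card _ hW, ← nsmul_eq_mul]
  · exact Finset.sum_le_card_nsmul _ _ _ fun J _ => hd J
  · intro J hJ
    by_contra hJW
    rw [Set.Finite.coe_toFinset] at hJW
    exact hJ (by simp [h J hJW])

theorem dist_le_mul_dist {x y x' y' : X} {C : ℝ}
    (h : ∀ J, dist (S.coord J x) (S.coord J y) ≤ C * dist (S.coord J x') (S.coord J y')) :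
    dist x y ≤ C * dist x' y' := by
  rw [S.dist_eq, S.dist_eq x' y', ← smul_eq_mul, smul_finsum]
  simp only [smul_eq_mul]
  exact finsum_le_finsum' (S.finite_support x y)
    ((S.finite_support x' y').subset fun J hJ h => hJ (by simp_all)) h

end Dist

/-- The hyperplanes at which three points have three distinct coordinates. -/
def tripleSet (x y z : X) : Set H :=
  {J | S.coord J x ≠ S.coord J y ∧ S.coord J x ≠ S.coord J z ∧ S.coord J y ≠ S.coord J z}

theorem tripleSet_finite (x y z : X) : (S.tripleSet x y z).Finite :=
  (S.finite_ne x y).subset fun _ h => h.1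

/-- Hyperplanes of the same type cannot both separate three points from each other. -/
theorem ncard_tripleSet_le [Finite V] (x y z : X) : (S.tripleSet x y z).ncard ≤ Nat.card V := by
  have hinj : Set.InjOn S.type (S.tripleSet x y z) := by
    intro J hJ K hK h
    by_contra hne
    obtain ⟨a, b, hab⟩ := S.sameType J K hne h
    obtain ⟨h1, h2, h3⟩ := hJ
    obtain ⟨h4, h5, h6⟩ := hK
    have hx := hab x
    have hy := hab y
    have hz := hab z
    -- two of the three points have the coordinate `a` at `J`, or two have `b` at `K`
    grind
  rw [← hinj.ncard_image, ← Set.ncard_univ]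
  exact Set.ncard_le_ncard (Set.subset_univ _)

/-- Coordinatewise coarse medians with exact majority vote define a coarse median. -/
theorem exists_isCoarseMedian (S : HyperplaneSystem X V H M) [Finite V] {κ : ℝ}
    (hκ : 0 ≤ κ) {μ : ∀ J, M J → M J → M J → M J}
    (hμ : ∀ J, IsCoarseMedianWith (μ J) κ)
    (hmaj : ∀ J a b, μ J a a b = a ∧ μ J a b a = a ∧ μ J b a a = a)
    (hdist : ∀ J (a b : M J), a ≠ b → 1 ≤ dist a b) :
    ∃ ν : X → X → X → X, IsCoarseMedian ν := by
  have hex : ∀ x y z, ∃ m, ∀ J, S.coord J m = μ J (S.coord J x) (S.coord J y) (S.coord J z) := by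
    intro x y z
    refine S.exists_coord_eq (fun J K a b _ h => ?_) x ?_
    · have hx := h x
      have hy := h y
      have hz := h z
      have h1 := hmaj J a
      have h2 := hmaj K b
      rcases hx with hx | hx <;> rcases hy with hy | hy <;> rcases hz with hz | hz <;>
        simp [hx, hy, hz, h1, h2]
    · refine ((S.finite_ne x y).union (S.finite_ne x z)).subset fun J hJ => ?_
      by_contra hc
      simp only [Set.mem_union, Set.mem_ofPred_eq, not_or, not_not] at hc
      exact hJ (by rw [← hc.1, ← hc.2, (hmaj J _ (S.coord J x)).1])
  choose ν hν using hex
  have htriple : ∀ {x y : X} {C : ℝ} (a b c : X), 0 ≤ C →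
      (∀ J, dist (S.coord J x) (S.coord J y) ≤ C) →
      (∀ J, J ∉ S.tripleSet a b c → S.coord J x = S.coord J y) → dist x y ≤ Nat.card V * C := by
    intro x y C a b c hC hd h
    refine (S.dist_le_ncard_mul (S.tripleSet_finite a b c) hd h).trans ?_
    gcongr
    exact S.ncard_tripleSet_le a b c
  have hV : (0 : ℝ) ≤ Nat.card V * κ := by positivity
  refine ⟨ν, 2 * (Nat.card V * κ) + 2 * κ, by positivity, ?_, ?_, ?_, ?_⟩
  · intro a b
    refine (htriple (C := 0) a a b le_rfl ?_ ?_).trans (by rw [mul_zero]; positivity)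
    · intro J
      rw [hν, (hmaj J _ _).1, dist_self]
    · intro J _
      rw [hν, (hmaj J _ _).1]
  · intro a σ
    have h1 : dist (ν (a (σ 0)) (a (σ 1)) (a (σ 2))) (ν (a 0) (a 1) (a 2)) ≤ Nat.card V * κ := by
      refine htriple (a 0) (a 1) (a 2) hκ ?_ ?_
      · intro J
        rw [hν, hν]
        exact (hμ J).symmetric (fun i => S.coord J (a i)) σ
      · intro J hJ
        rw [hν, hν]
        exact majority_perm (hmaj J) (f := fun i => S.coord J (a i)) hJ σ
    linarith
  · intro a a' b c
    have h1 : dist (ν a b c) (ν a' b c) ≤ (2 * κ) * dist a a' := by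
      refine S.dist_le_mul_dist fun J => ?_
      rw [hν, hν]
      by_cases h : S.coord J a = S.coord J a'
      · rw [h, dist_self, dist_self, mul_zero]
      · have h2 := (hμ J).coarseLipschitz (S.coord J a) (S.coord J a') (S.coord J b) (S.coord J c)
        have h3 := mul_le_mul_of_nonneg_left (hdist J _ _ h) hκ
        linarith
    have h2 : 0 ≤ (Nat.card V * κ) * dist a a' := by positivity
    nlinarith
  · intro a b c d
    have h1 : dist (ν (ν a b c) b d) (ν a b (ν c b d)) ≤
        (S.tripleSet a b d ∪ S.tripleSet b c d).ncard * κ := by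
      refine S.dist_le_ncard_mul ?_ ?_ ?_
      · exact (S.tripleSet_finite _ _ _).union (S.tripleSet_finite _ _ _)
      · intro J
        simp only [hν]
        exact (hμ J).fourPoint _ _ _ _
      · intro J hJ
        simp only [hν]
        simp only [tripleSet, Set.mem_union, Set.mem_ofPred_eq, not_or] at hJ
        exact majority_fourPoint (hmaj J) hJ.1 hJ.2
    have h2 : ((S.tripleSet a b d ∪ S.tripleSet b c d).ncard : ℝ) ≤ 2 * Nat.card V := by
      have e := (Set.ncard_union_le _ _).trans
        (add_le_add (S.ncard_tripleSet_le a b d) (S.ncard_tripleSet_le b c d))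
      rw [← two_mul] at e
      exact_mod_cast e
    have h3 := mul_le_mul_of_nonneg_right h2 hκ
    linarith

end HyperplaneSystem

/-! ### Heads in a free product of copies of one group -/

section FreeProductHead

open Monoid

variable {I M : Type*} [Group M]

/-- The free product of copies of `M` indexed by `I`. -/
abbrev FreeCopies (I M : Type*) [Group M] : Type _ := CoprodI fun _ : I => M

/-- The inclusion of the copy of `M` with index `i`. -/
def FreeCopies.of (i : I) : M →* FreeCopies I M := CoprodI.of (M := fun _ : I => M) (i := i)

open Classical in
/-- The first letter of the reduced word of `x`, if this letter comes from the copy with index `i`,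
and `1` otherwise. -/
noncomputable def FreeCopies.head (i : I) (x : FreeCopies I M) : M :=
  (CoprodI.Word.equivPair i (CoprodI.Word.equiv x)).head

namespace FreeCopies

theorem head_eq [DecidableEq I] [DecidableEq M] (i : I) (x : FreeCopies I M) :
    head i x = (CoprodI.Word.equivPair i (CoprodI.Word.equiv x)).head := by
  unfold head
  congr!

theorem head_one (i : I) : head i (1 : FreeCopies I M) = 1 := by
  classical
  rw [head_eq, CoprodI.Word.equivPair_eq_of_fstIdx_ne]
  convert (by simp [CoprodI.Word.fstIdx] :
    CoprodI.Word.fstIdx (CoprodI.Word.empty : CoprodI.Word fun _ : I => M) ≠ some i)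
  simp [CoprodI.Word.equiv]

theorem head_of_mul (i : I) (m : M) (x : FreeCopies I M) :
    head i (of i m * x) = m * head i x := by
  classical
  have h : CoprodI.Word.equiv (of i m * x) =
      (CoprodI.of (M := fun _ : I => M) (i := i) m) • CoprodI.Word.equiv x := by
    simp [CoprodI.Word.equiv, mul_smul, of]
  have h2 := CoprodI.Word.equivPair_smul_same (M := fun _ : I => M) (i := i) m
    (CoprodI.Word.equiv x)
  rw [← h] at h2
  rw [head_eq, head_eq, h2]

theorem head_of_mul_of_ne {i j : I} (hij : j ≠ i) {m : M} (hm : m ≠ 1) {x : FreeCopies I M}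
    (hx : head i x = 1) : head j (of i m * x) = 1 := by
  classical
  set w := CoprodI.Word.equiv x with hw
  have hx' : (CoprodI.Word.equivPair i w).head = 1 := by
    rw [← hx, head_eq]
  have h : CoprodI.Word.equiv (of i m * x) =
      (CoprodI.of (M := fun _ : I => M) (i := i) m) • w := by
    simp [CoprodI.Word.equiv, mul_smul, of, hw]
  have h2 : (CoprodI.of (M := fun _ : I => M) (i := i) m) • w =
      CoprodI.Word.cons (M := fun _ : I => M) m (CoprodI.Word.equivPair i w).tail
        (CoprodI.Word.equivPair i w).fstIdx_ne hm := by
    rw [CoprodI.Word.of_smul_def]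
    simp [CoprodI.Word.rcons, hx', hm]
  have h3 : CoprodI.Word.fstIdx (CoprodI.Word.equiv (of i m * x)) ≠ some j := by
    rw [h, h2, CoprodI.Word.fstIdx_cons]
    simpa using hij.symm
  rw [head_eq, CoprodI.Word.equivPair_eq_of_fstIdx_ne h3]

/-- Induction along reduced words. -/
theorem reduced_induction {p : FreeCopies I M → Prop} (one : p 1)
    (of_mul : ∀ i (m : M) x, m ≠ 1 → head i x = 1 → p x → p (of i m * x)) (x : FreeCopies I M) :
    p x := by
  classical
  obtain ⟨w, rfl⟩ := CoprodI.Word.equiv.symm.surjective x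
  induction w using CoprodI.Word.consRecOn with
  | empty => exact one
  | cons i m w h1 h2 ih =>
    have h : CoprodI.Word.equiv.symm (CoprodI.Word.cons m w h1 h2) =
        of i m * CoprodI.Word.equiv.symm w := by
      simp [CoprodI.Word.equiv, of]
    rw [h]
    refine of_mul i m _ h2 ?_ ih
    rw [head_eq, Equiv.apply_symm_apply, CoprodI.Word.equivPair_eq_of_fstIdx_ne h1]

theorem head_of_same (i : I) (m : M) : head i (of i m) = m := by
  have h := head_of_mul i m 1
  rwa [mul_one, head_one, mul_one] at h

theorem head_of_ne {i j : I} (h : j ≠ i) (m : M) : head j (of i m) = 1 := by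
  by_cases hm : m = 1
  · rw [hm, map_one, head_one]
  · have h := head_of_mul_of_ne h hm (head_one i)
    rwa [mul_one] at h

/-- Right multiplication by an element of the copy `j` changes the head at `i` only inside the
copy `i`, and only for `j = i`. -/
theorem head_mul_of (x : FreeCopies I M) (i j : I) (s : M) (h : head i (x * of j s) ≠ head i x) :
    j = i ∧ ∃ m, x = of i m := by
  induction x using reduced_induction generalizing i with
  | one =>
    rw [one_mul, head_one] at h
    refine ⟨?_, 1, (map_one _).symm⟩
    by_contra hji
    exact h (head_of_ne (Ne.symm hji) s)
  | of_mul k t w ht hw ih =>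
    rw [mul_assoc] at h
    by_cases hk : head k (w * of j s) = 1
    · exfalso
      by_cases hik : i = k
      · subst hik
        rw [head_of_mul, head_of_mul, hk, hw] at h
        exact h rfl
      · rw [head_of_mul_of_ne hik ht hk, head_of_mul_of_ne hik ht hw] at h
        exact h rfl
    · obtain ⟨rfl, m, rfl⟩ := ih k (by rwa [hw])
      rw [head_of_same] at hw
      subst hw
      rw [map_one, mul_one, one_mul, ← map_mul] at h
      rw [map_one, mul_one]
      by_cases hij : i = j
      · exact ⟨hij.symm, t, by rw [hij]⟩
      · rw [head_of_ne hij, head_of_ne hij] at h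
        exact absurd rfl h

section Relabel

variable {P : Type*} [Group P] [MulAction P I]

/-- The endomorphism of the free product that moves the copy `i` to the copy `p • i`. -/
def relabel (p : P) : FreeCopies I M →* FreeCopies I M :=
  CoprodI.lift fun i => of (p • i)

@[simp]
theorem relabel_of (p : P) (i : I) (m : M) : relabel p (of i m) = of (p • i) m :=
  CoprodI.lift_of _ _

theorem hom_ext {N : Type*} [Group N] {f g : FreeCopies I M →* N}
    (h : ∀ i m, f (of i m) = g (of i m)) : f = g :=
  CoprodI.ext_hom _ _ fun i => MonoidHom.ext fun m => h i m

theorem relabel_mul (p q : P) (x : FreeCopies I M) :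
    relabel (p * q) x = relabel p (relabel q x) := by
  have h : relabel (I := I) (M := M) (p * q) = (relabel p).comp (relabel q) :=
    hom_ext fun i m => by simp [mul_smul]
  exact DFunLike.congr_fun h x

theorem relabel_one (x : FreeCopies I M) : relabel (1 : P) x = x := by
  have h : relabel (I := I) (M := M) (1 : P) = MonoidHom.id _ :=
    hom_ext fun i m => by simp
  exact DFunLike.congr_fun h x

variable (I M P) in
/-- The action of `P` on the free product by permuting the copies of `M`. -/
def relabelAut : P →* MulAut (FreeCopies I M) where
  toFun p :=
    { toFun := relabel p
      invFun := relabel p⁻¹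
      left_inv x := by rw [← relabel_mul, inv_mul_cancel, relabel_one]
      right_inv x := by rw [← relabel_mul, mul_inv_cancel, relabel_one]
      map_mul' := map_mul _ }
  map_one' := MulEquiv.ext relabel_one
  map_mul' p q := MulEquiv.ext (relabel_mul p q)

@[simp]
theorem relabelAut_apply (p : P) (x : FreeCopies I M) : relabelAut I M P p x = relabel p x := rfl

theorem head_relabel (p : P) (x : FreeCopies I M) (i : I) :
    head (p • i) (relabel p x) = head i x := by
  induction x using reduced_induction generalizing i with
  | one => rw [map_one, head_one, head_one]
  | of_mul k t w ht hw ih =>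
    rw [map_mul, relabel_of]
    by_cases hik : i = k
    · subst hik
      rw [head_of_mul, head_of_mul, ih]
    · rw [head_of_mul_of_ne hik ht hw, head_of_mul_of_ne (fun h => hik (smul_left_cancel p h)) ht]
      rw [ih, hw]

end Relabel

end FreeCopies

end FreeProductHead

/-! ### Vertex groups, links and stars in a graph product -/

namespace GraphProduct

open Monoid

variable {V : Type*} {Γ : SimpleGraph V} {G : V → Type*} [∀ u, Group (G u)]

variable (Γ) in
/-- The homomorphism from the vertex group `G u` to the graph product. -/
def of (u : V) : G u →* GraphProduct Γ G :=
  (QuotientGroup.mk' _).comp (CoprodI.of (M := G) (i := u))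

theorem of_commute {u v : V} (h : Γ.Adj u v) (g : G u) (k : G v) :
    of Γ u g * of Γ v k = of Γ v k * of Γ u g := by
  rw [← commutatorElement_eq_one_iff_mul_comm]
  exact (QuotientGroup.eq_one_iff _).2 (Subgroup.subset_normalClosure ⟨u, v, h, g, k, rfl⟩)

/-- The universal property of the graph product. -/
def lift {H : Type*} [Group H] (f : ∀ u, G u →* H)
    (hf : ∀ u v, Γ.Adj u v → ∀ g k, f u g * f v k = f v k * f u g) : GraphProduct Γ G →* H :=
  QuotientGroup.lift _ (CoprodI.lift f) fun x hx => by
    have hle : Subgroup.normalClosure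
        {x : CoprodI G | ∃ u v : V, Γ.Adj u v ∧ ∃ (g : G u) (h : G v),
          x = ⁅(CoprodI.of g : CoprodI G), (CoprodI.of h : CoprodI G)⁆} ≤
        (CoprodI.lift f).ker := by
      refine Subgroup.normalClosure_le_normal ?_
      rintro _ ⟨u, v, h, g, k, rfl⟩
      rw [SetLike.mem_coe, MonoidHom.mem_ker, map_commutatorElement,
        commutatorElement_eq_one_iff_mul_comm, CoprodI.lift_of, CoprodI.lift_of]
      exact hf u v h g k
    exact hle hx

@[simp]
theorem lift_of {H : Type*} [Group H] (f : ∀ u, G u →* H)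
    (hf : ∀ u v, Γ.Adj u v → ∀ g k, f u g * f v k = f v k * f u g) (u : V) (g : G u) :
    lift (Γ := Γ) f hf (of Γ u g) = f u g :=
  CoprodI.lift_of _ _

theorem closure_eq_top :
    Subgroup.closure {x : GraphProduct Γ G | ∃ u, ∃ g : G u, x = of Γ u g} = ⊤ := by
  rw [eq_top_iff]
  rintro x -
  obtain ⟨y, rfl⟩ := QuotientGroup.mk'_surjective _ x
  induction y using CoprodI.induction_on with
  | one => rw [map_one]; exact one_mem _
  | of u g => exact Subgroup.subset_closure ⟨u, g, rfl⟩
  | mul x y hx hy => rw [map_mul]; exact mul_mem hx hy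

theorem hom_ext {H : Type*} [Group H] {f g : GraphProduct Γ G →* H}
    (h : ∀ u x, f (of Γ u x) = g (of Γ u x)) : f = g := by
  refine MonoidHom.eq_of_eqOn_dense closure_eq_top ?_
  rintro _ ⟨u, x, rfl⟩
  exact h u x

/-- The element represented by a word whose letters are elements of vertex groups. -/
def wordProd (l : List (Σ u, G u)) : GraphProduct Γ G := (l.map fun s => of Γ s.1 s.2).prod

variable (Γ) in
@[simp]
theorem wordProd_nil : wordProd (Γ := Γ) ([] : List (Σ u, G u)) = 1 := rfl

@[simp]
theorem wordProd_cons (s : Σ u, G u) (l : List (Σ u, G u)) :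
    wordProd (Γ := Γ) (s :: l) = of Γ s.1 s.2 * wordProd l := by simp [wordProd]

@[simp]
theorem wordProd_append (l l' : List (Σ u, G u)) :
    wordProd (Γ := Γ) (l ++ l') = wordProd l * wordProd l' := by simp [wordProd]

theorem exists_wordProd (x : GraphProduct Γ G) : ∃ l, wordProd l = x := by
  have hx : x ∈ Subgroup.closure {x : GraphProduct Γ G | ∃ u, ∃ g : G u, x = of Γ u g} := by
    rw [closure_eq_top]; trivial
  induction hx using Subgroup.closure_induction'' with
  | one => exact ⟨[], rfl⟩
  | mem x hx => obtain ⟨u, g, rfl⟩ := hx; exact ⟨[⟨u, g⟩], by simp⟩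
  | inv_mem x hx => obtain ⟨u, g, rfl⟩ := hx; exact ⟨[⟨u, g⁻¹⟩], by simp⟩
  | mul x y _ _ hx hy =>
    obtain ⟨l, rfl⟩ := hx
    obtain ⟨l', rfl⟩ := hy
    exact ⟨l ++ l', by simp⟩

/-- Induction by multiplying with elements of vertex groups on the right. -/
theorem right_induction {p : GraphProduct Γ G → Prop} (one : p 1)
    (mul_of : ∀ x u (g : G u), p x → p (x * of Γ u g)) (x : GraphProduct Γ G) : p x := by
  obtain ⟨l, rfl⟩ := exists_wordProd x
  induction l using List.reverseRecOn with
  | nil => exact one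
  | append_singleton l s ih =>
    rw [wordProd_append, wordProd_cons, wordProd_nil, mul_one]
    exact mul_of _ _ _ ih

variable (Γ G) in
/-- The subgroup generated by the vertex groups of the neighbours of `u`. -/
def link (u : V) : Subgroup (GraphProduct Γ G) :=
  Subgroup.closure {x | ∃ w, Γ.Adj u w ∧ ∃ g : G w, x = of Γ w g}

variable (Γ G) in
/-- The subgroup generated by the vertex groups of `u` and of its neighbours. -/
def star (u : V) : Subgroup (GraphProduct Γ G) :=
  Subgroup.closure {x | ∃ w, (w = u ∨ Γ.Adj u w) ∧ ∃ g : G w, x = of Γ w g}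

theorem of_mem_link {u w : V} (h : Γ.Adj u w) (g : G w) : of Γ w g ∈ link Γ G u :=
  Subgroup.subset_closure ⟨w, h, g, rfl⟩

theorem of_mem_star {u w : V} (h : w = u ∨ Γ.Adj u w) (g : G w) : of Γ w g ∈ star Γ G u :=
  Subgroup.subset_closure ⟨w, h, g, rfl⟩

theorem of_self_mem_star {u : V} (g : G u) : of Γ u g ∈ star Γ G u :=
  of_mem_star (Or.inl rfl) g

theorem link_le_star (u : V) : link Γ G u ≤ star Γ G u :=
  Subgroup.closure_mono fun _ ⟨w, h, g, hx⟩ => ⟨w, Or.inr h, g, hx⟩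

theorem link_commute {u : V} {c : GraphProduct Γ G} (hc : c ∈ link Γ G u) (g : G u) :
    c * of Γ u g = of Γ u g * c := by
  have h : link Γ G u ≤ Subgroup.centralizer {of Γ u g} := by
    refine (Subgroup.closure_le _).2 ?_
    rintro _ ⟨w, hw, k, rfl⟩
    rw [SetLike.mem_coe, Subgroup.mem_centralizer_singleton_iff]
    exact of_commute hw.symm k g
  exact Subgroup.mem_centralizer_singleton_iff.1 (h hc)

/-! ### The head of an element at a vertex -/

section Head

variable (Γ G) in
/-- The cosets of the link of `u` in the whole graph product. Each of them determines a conjugate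
of `G u`, since the link commutes with `G u`. -/
abbrev LinkCoset (u : V) : Type _ := GraphProduct Γ G ⧸ link Γ G u

variable (Γ G) in
/-- The semidirect product of the graph product with the free product of copies of `G u` indexed by
the cosets of the link of `u`, which the graph product permutes. -/
abbrev Split (u : V) : Type _ :=
  FreeCopies (LinkCoset Γ G u) (G u) ⋊[FreeCopies.relabelAut (LinkCoset Γ G u) (G u)
    (GraphProduct Γ G)] GraphProduct Γ G

variable (Γ G) in
/-- The base coset of the link of `u`. -/
def baseCoset (u : V) : LinkCoset Γ G u := QuotientGroup.mk 1

theorem smul_baseCoset {u : V} {x : GraphProduct Γ G} (hx : x ∈ link Γ G u) :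
    x • baseCoset Γ G u = baseCoset Γ G u := by
  change (QuotientGroup.mk (x * 1) : LinkCoset Γ G u) = QuotientGroup.mk 1
  rw [mul_one, QuotientGroup.eq, mul_one]
  exact inv_mem hx

theorem mem_link_of_smul_baseCoset {u : V} {x : GraphProduct Γ G}
    (hx : x • baseCoset Γ G u = baseCoset Γ G u) : x ∈ link Γ G u := by
  change (QuotientGroup.mk (x * 1) : LinkCoset Γ G u) = QuotientGroup.mk 1 at hx
  rw [mul_one, QuotientGroup.eq, mul_one] at hx
  exact inv_mem_iff.1 hx

open Classical in
variable (Γ G) in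
/-- The homomorphism to `Split Γ G u` that sends `G u` to the copy of `G u` at the base coset, and
every other vertex group to itself in the second factor. -/
noncomputable def splitHom (u : V) : GraphProduct Γ G →* Split Γ G u :=
  lift (fun w => if h : w = u then
      SemidirectProduct.inl.comp
        ((FreeCopies.of (baseCoset Γ G u)).comp (h ▸ MonoidHom.id (G w) : G w →* G u))
    else SemidirectProduct.inr.comp (of Γ w)) <| by
  have key : ∀ w, Γ.Adj u w → ∀ (g : G u) (k : G w),
      (SemidirectProduct.inl (FreeCopies.of (baseCoset Γ G u) g) : Split Γ G u) *
        SemidirectProduct.inr (of Γ w k) =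
      SemidirectProduct.inr (of Γ w k) *
        SemidirectProduct.inl (FreeCopies.of (baseCoset Γ G u) g) := by
    intro w h g k
    ext
    · simp [smul_baseCoset (of_mem_link h k)]
    · simp
  intro v w h g k
  by_cases hv : v = u
  · subst hv
    have hw : w ≠ v := h.ne'
    simpa [hw] using key w h g k
  · by_cases hw : w = u
    · subst hw
      simpa [hv] using (key v h.symm k g).symm
    · simp only [hv, hw, dite_false, MonoidHom.comp_apply, ← map_mul, of_commute h]

theorem splitHom_of_self (u : V) (g : G u) :
    splitHom Γ G u (of Γ u g) = SemidirectProduct.inl (FreeCopies.of (baseCoset Γ G u) g) := by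
  simp [splitHom]

theorem splitHom_of_ne {u w : V} (h : w ≠ u) (g : G w) :
    splitHom Γ G u (of Γ w g) = SemidirectProduct.inr (of Γ w g) := by
  simp [splitHom, h]

variable (Γ G) in
/-- The homomorphism that sends the copy of `G u` at the coset of `p` to the conjugate of `G u` by
`p`. -/
noncomputable def conjHom (u : V) : FreeCopies (LinkCoset Γ G u) (G u) →* GraphProduct Γ G :=
  CoprodI.lift fun q => (MulAut.conj q.out).toMonoidHom.comp (of Γ u)

theorem conjHom_of {u : V} {q : LinkCoset Γ G u} {p : GraphProduct Γ G}
    (hp : QuotientGroup.mk p = q) (g : G u) :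
    conjHom Γ G u (FreeCopies.of q g) = p * of Γ u g * p⁻¹ := by
  obtain ⟨c, hc⟩ := QuotientGroup.mk_out_eq_mul (link Γ G u) p
  rw [hp] at hc
  rw [conjHom, FreeCopies.of, CoprodI.lift_of]
  simp only [MonoidHom.comp_apply, MulEquiv.coe_toMonoidHom, MulAut.conj_apply]
  rw [hc]
  calc p * c * of Γ u g * (p * c)⁻¹ = p * (c * of Γ u g) * (p * c)⁻¹ := by group
    _ = p * of Γ u g * p⁻¹ := by rw [link_commute c.2 g]; group

variable (Γ G) in
/-- The homomorphism from `Split Γ G u` that is `conjHom` on the free product and the identity on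
the graph product. -/
noncomputable def unsplitHom (u : V) : Split Γ G u →* GraphProduct Γ G :=
  SemidirectProduct.lift (conjHom Γ G u) (MonoidHom.id _) <| by
  intro x
  refine FreeCopies.hom_ext fun q g => ?_
  obtain ⟨p, rfl⟩ := QuotientGroup.mk_surjective q
  simp only [MonoidHom.comp_apply, MulEquiv.coe_toMonoidHom, MulAut.conj_apply,
    MonoidHom.id_apply, FreeCopies.relabelAut_apply, FreeCopies.relabel_of]
  rw [conjHom_of (p := p) rfl,
    conjHom_of (q := x • (QuotientGroup.mk p : LinkCoset Γ G u)) (p := x * p) rfl]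
  group

theorem unsplitHom_splitHom (u : V) (x : GraphProduct Γ G) :
    unsplitHom Γ G u (splitHom Γ G u x) = x := by
  have h : (unsplitHom Γ G u).comp (splitHom Γ G u) = MonoidHom.id _ := by
    refine hom_ext fun w g => ?_
    by_cases hw : w = u
    · subst hw
      rw [MonoidHom.comp_apply, splitHom_of_self, unsplitHom, SemidirectProduct.lift_inl,
        conjHom_of (q := baseCoset Γ G w) (p := 1) rfl]
      simp
    · rw [MonoidHom.comp_apply, splitHom_of_ne hw, unsplitHom, SemidirectProduct.lift_inr]
  exact DFunLike.congr_fun h x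

variable (Γ G) in
/-- The head of `x` at `u`: the first syllable of a reduced word of `x`, where this syllable can be
shuffled to be in `G u`, and `1` where it cannot. It is the projection of `x` to `G u` in the
Cayley graph. -/
noncomputable def head (u : V) (x : GraphProduct Γ G) : G u :=
  FreeCopies.head (baseCoset Γ G u) (splitHom Γ G u x).left

theorem head_one (u : V) : head Γ G u 1 = 1 := by
  rw [head, map_one, SemidirectProduct.one_left, FreeCopies.head_one]

theorem head_of_mul (u : V) (g : G u) (x : GraphProduct Γ G) :
    head Γ G u (of Γ u g * x) = g * head Γ G u x := by
  rw [head, map_mul, splitHom_of_self, SemidirectProduct.mul_left]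
  simp [FreeCopies.head_of_mul, head]

theorem head_of_mul_of_adj {u w : V} (h : Γ.Adj u w) (g : G w) (x : GraphProduct Γ G) :
    head Γ G u (of Γ w g * x) = head Γ G u x := by
  rw [head, map_mul, splitHom_of_ne h.ne', SemidirectProduct.mul_left]
  have h2 := FreeCopies.head_relabel (of Γ w g) (splitHom Γ G u x).left (baseCoset Γ G u)
  rw [smul_baseCoset (of_mem_link h g)] at h2
  simpa [head] using h2

/-- The head at `u` changes only along those edges of the Cayley graph that are labelled by `G u`
and lie in the star of `u`. -/
theorem head_mul_of {u w : V} {x : GraphProduct Γ G} {s : G w}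
    (h : head Γ G u (x * of Γ w s) ≠ head Γ G u x) : w = u ∧ x ∈ star Γ G u := by
  by_cases hw : w = u
  · subst hw
    refine ⟨rfl, ?_⟩
    have hx := unsplitHom_splitHom w x
    unfold head at h
    rw [map_mul, splitHom_of_self, SemidirectProduct.mul_left, SemidirectProduct.left_inl,
      FreeCopies.relabelAut_apply, FreeCopies.relabel_of] at h
    obtain ⟨h1, m, hm⟩ := FreeCopies.head_mul_of _ _ _ _ h
    have hr := mem_link_of_smul_baseCoset h1
    have hs : splitHom Γ G w x = splitHom Γ G w (of Γ w m) *
        SemidirectProduct.inr (splitHom Γ G w x).right := by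
      rw [splitHom_of_self, ← hm, SemidirectProduct.inl_left_mul_inr_right]
    rw [hs, map_mul, unsplitHom_splitHom, unsplitHom, SemidirectProduct.lift_inr] at hx
    rw [← hx]
    exact mul_mem (of_self_mem_star m) (link_le_star w hr)
  · exfalso
    unfold head at h
    rw [map_mul, splitHom_of_ne hw, SemidirectProduct.mul_left, SemidirectProduct.left_inr,
      map_one, mul_one] at h
    exact h rfl

theorem head_of_self (u : V) (g : G u) : head Γ G u (of Γ u g) = g := by
  have h := head_of_mul (Γ := Γ) u g 1
  rwa [mul_one, head_one, mul_one] at h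

theorem head_mul_of_mem_star {u : V} {k : GraphProduct Γ G} (hk : k ∈ star Γ G u)
    (x : GraphProduct Γ G) : head Γ G u (k * x) = head Γ G u k * head Γ G u x := by
  induction hk using Subgroup.closure_induction generalizing x with
  | mem k hk =>
    obtain ⟨w, hw | hw, g, rfl⟩ := hk
    · subst hw
      rw [head_of_mul, head_of_self]
    · have h := head_of_mul_of_adj hw g 1
      rw [mul_one, head_one] at h
      rw [head_of_mul_of_adj hw, h, one_mul]
  | one => rw [one_mul, head_one, one_mul]
  | mul k k' _ _ h h' => rw [mul_assoc, h, h', h, mul_assoc]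
  | inv k _ h =>
    have h1 := h (k⁻¹ * x)
    have h2 := h k⁻¹
    rw [mul_inv_cancel_left] at h1
    rw [mul_inv_cancel, head_one] at h2
    rw [h1, ← mul_assoc, mul_eq_one_iff_eq_inv.1 h2.symm, mul_inv_cancel, one_mul]

theorem mem_star_mul_of {u : V} {k : GraphProduct Γ G} (hk : k ∈ star Γ G u) (g : G u) :
    k * of Γ u g = of Γ u (head Γ G u k * g * (head Γ G u k)⁻¹) * k := by
  induction hk using Subgroup.closure_induction generalizing g with
  | mem k hk =>
    obtain ⟨w, hw | hw, a, rfl⟩ := hk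
    · subst hw
      rw [head_of_self, ← map_mul, ← map_mul, inv_mul_cancel_right]
    · have h := head_of_mul_of_adj hw a 1
      rw [mul_one, head_one] at h
      rw [h, one_mul, inv_one, mul_one, of_commute hw]
  | one => simp [head_one]
  | mul k k' hk _ h h' =>
    rw [mul_assoc, h', ← mul_assoc, h, head_mul_of_mem_star hk, mul_assoc _ k k']
    simp [mul_assoc]
  | inv k hk h =>
    have h2 := head_mul_of_mem_star hk k⁻¹
    rw [mul_inv_cancel, head_one] at h2
    rw [eq_inv_of_mul_eq_one_right h2.symm, inv_inv, inv_mul_eq_iff_eq_mul, ← mul_assoc, h]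
    simp [mul_assoc]

/-- A nontrivial head can be split off, which shortens a word by at least one syllable. -/
theorem exists_shorter_word (u : V) (l : List (Σ u, G u))
    (h : head Γ G u (wordProd l) ≠ 1) :
    ∃ l' : List (Σ u, G u), l'.length < l.length ∧
      wordProd l' = of Γ u (head Γ G u (wordProd l))⁻¹ * wordProd l := by
  induction l using List.reverseRecOn with
  | nil => exact absurd (head_one u) h
  | append_singleton l s ih =>
    obtain ⟨w, s⟩ := s
    simp only [wordProd_append, wordProd_cons, wordProd_nil, mul_one, List.length_append,
      List.length_singleton] at h ⊢
    by_cases hs : head Γ G u (wordProd l * of Γ w s) = head Γ G u (wordProd l)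
    · rw [hs] at h ⊢
      obtain ⟨l', hl', hp⟩ := ih h
      exact ⟨l' ++ [⟨w, s⟩], by simpa using hl', by simp [hp, mul_assoc]⟩
    · obtain ⟨rfl, hl⟩ := head_mul_of hs
      -- the last syllable cancels the head, as it commutes with the part in between
      have hp : of Γ w (head Γ G w (wordProd l * of Γ w s))⁻¹ * (wordProd l * of Γ w s) =
          of Γ w (head Γ G w (wordProd l))⁻¹ * wordProd l := by
        rw [head_mul_of_mem_star hl, head_of_self, mem_star_mul_of hl, ← mul_assoc, ← map_mul]
        congr 2
        group
      rw [hp]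
      by_cases h1 : head Γ G w (wordProd l) = 1
      · exact ⟨l, Nat.lt_succ_self _, by simp [h1]⟩
      · obtain ⟨l', hl', hp'⟩ := ih h1
        exact ⟨l', hl'.trans (Nat.lt_succ_self _), hp'⟩

theorem eq_one_of_head_eq_one {x : GraphProduct Γ G} (h : ∀ u, head Γ G u x = 1) : x = 1 := by
  have key : ∀ (n : ℕ) (l : List (Σ u, G u)), l.length = n →
      (∀ u, head Γ G u (wordProd l) = 1) → wordProd (Γ := Γ) l = 1 := by
    intro n
    induction n using Nat.strong_induction_on with
    | _ n ih =>
      rintro (_ | ⟨⟨u, g⟩, l⟩) hn hl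
      · rfl
      · rw [List.length_cons] at hn
        rw [wordProd_cons] at hl ⊢
        have hu := hl u
        rw [head_of_mul, mul_eq_one_iff_inv_eq] at hu
        by_cases h1 : head Γ G u (wordProd l) = 1
        · rw [h1, inv_eq_one] at hu
          rw [hu, map_one, one_mul] at hl ⊢
          exact ih l.length (by omega) l rfl hl
        · obtain ⟨l', hl', hp⟩ := exists_shorter_word u l h1
          rw [← hu, inv_inv] at hp
          rw [← hp] at hl ⊢
          exact ih l'.length (by omega) l' rfl hl
  obtain ⟨l, rfl⟩ := exists_wordProd x
  exact key _ l rfl h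

end Head

/-! ### Hyperplanes and their coordinates -/

section Hyperplanes

variable (Γ G) in
/-- The hyperplanes of the graph product, that is, the classes of parallel cosets of vertex groups:
those with vertex `u` correspond to the cosets of the star of `u`. -/
abbrev Hyperplane : Type _ := Σ u, GraphProduct Γ G ⧸ star Γ G u

/-- The hyperplane of the coset `x * G u`. -/
abbrev hyperplane (u : V) (x : GraphProduct Γ G) : Hyperplane Γ G := ⟨u, QuotientGroup.mk x⟩

/-- The coordinate of `x` at a hyperplane: the projection of `x` to one of the parallel cosets of
the vertex group, all of which are identified with the group by a choice of base point. -/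
noncomputable def coord (J : Hyperplane Γ G) (x : GraphProduct Γ G) : G J.1 :=
  head Γ G J.1 (J.2.out⁻¹ * x)

theorem hyperplane_eq_iff {u : V} {x y : GraphProduct Γ G} :
    hyperplane u x = hyperplane u y ↔ x⁻¹ * y ∈ star Γ G u := by
  rw [← QuotientGroup.eq]
  exact ⟨fun h => eq_of_heq (Sigma.mk.inj h).2, fun h => congrArg (Sigma.mk u) h⟩

theorem out_hyperplane_inv_mul_mem (u : V) (x : GraphProduct Γ G) :
    (hyperplane u x).2.out⁻¹ * x ∈ star Γ G u := by
  rw [← QuotientGroup.eq]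
  exact QuotientGroup.out_eq' _

theorem coord_hyperplane (u : V) (x y : GraphProduct Γ G) :
    coord (hyperplane u x) (x * y) = coord (hyperplane u x) x * head Γ G u y := by
  have h := head_mul_of_mem_star (out_hyperplane_inv_mul_mem u x) y
  rw [mul_assoc] at h
  exact h

theorem coord_mul_of {J : Hyperplane Γ G} {x : GraphProduct Γ G} {w : V} {s : G w}
    (h : coord J (x * of Γ w s) ≠ coord J x) : w = J.1 ∧ hyperplane J.1 x = J := by
  unfold coord at h
  rw [← mul_assoc] at h
  obtain ⟨h1, h2⟩ := head_mul_of h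
  refine ⟨h1, ?_⟩
  rw [← QuotientGroup.eq, QuotientGroup.out_eq'] at h2
  exact Sigma.ext rfl (heq_of_eq h2.symm)

theorem coord_mul_of_ne {J : Hyperplane Γ G} {x : GraphProduct Γ G} {w : V} (s : G w)
    (h : J ≠ hyperplane w x) : coord J (x * of Γ w s) = coord J x := by
  by_contra hc
  obtain ⟨rfl, hJ⟩ := coord_mul_of hc
  exact h hJ.symm

theorem hyperplane_mul_of {u w : V} (h : w = u ∨ Γ.Adj u w) (x : GraphProduct Γ G) (s : G w) :
    hyperplane u (x * of Γ w s) = hyperplane u x :=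
  (hyperplane_eq_iff.2 (by simpa using of_mem_star h s)).symm

theorem exists_coord_ne {x y : GraphProduct Γ G} (h : x ≠ y) :
    ∃ u, coord (hyperplane u x) x ≠ coord (hyperplane u x) y := by
  by_contra! hc
  refine h (inv_mul_eq_one.1 (eq_one_of_head_eq_one (x := x⁻¹ * y) fun u => ?_))
  have hu := coord_hyperplane u x (x⁻¹ * y)
  rw [mul_inv_cancel_left, ← hc u] at hu
  exact left_eq_mul.1 hu

theorem finite_coord_ne (x y : GraphProduct Γ G) :
    {J : Hyperplane Γ G | coord J x ≠ coord J y}.Finite := by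
  have key : ∀ z : GraphProduct Γ G, {J : Hyperplane Γ G | coord J x ≠ coord J (x * z)}.Finite := by
    intro z
    induction z using right_induction with
    | one => simp
    | mul_of z u g ih =>
      refine (ih.insert (hyperplane u (x * z))).subset fun J hJ => ?_
      by_cases h : J = hyperplane u (x * z)
      · exact Or.inl h
      · right
        rwa [Set.mem_ofPred_eq, ← mul_assoc, coord_mul_of_ne g h] at hJ
  simpa using key (x⁻¹ * y)

/-- The coordinate at a hyperplane is constant along every other hyperplane that is not transverse
to it. -/
theorem coord_eq_of_hyperplane_eq {J : Hyperplane Γ G} {u : V} {x y : GraphProduct Γ G}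
    (hJ : J ≠ hyperplane u x) (hadj : ¬ Γ.Adj u J.1) (h : hyperplane u x = hyperplane u y) :
    coord J y = coord J x := by
  have key : ∀ k ∈ star Γ G u, ∀ z, hyperplane u z = hyperplane u x →
      coord J (z * k) = coord J z := by
    intro k hk
    induction hk using Subgroup.closure_induction with
    | mem k hk =>
      obtain ⟨w, hw, g, rfl⟩ := hk
      intro z hz
      by_contra hc
      obtain ⟨rfl, h2⟩ := coord_mul_of hc
      rcases hw with hw | hw
      · rw [hw, hz] at h2
        exact hJ h2.symm
      · exact hadj hw
    | one => simp
    | mul k k' hk _ h h' =>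
      intro z hz
      rw [← mul_assoc, h' (z * k), h z hz]
      rw [← hz, eq_comm, hyperplane_eq_iff, inv_mul_cancel_left]
      exact hk
    | inv k hk h =>
      intro z hz
      rw [← h (z * k⁻¹), inv_mul_cancel_right]
      rw [← hz, eq_comm, hyperplane_eq_iff, inv_mul_cancel_left]
      exact inv_mem hk
  have := key _ (hyperplane_eq_iff.1 h) x rfl
  rwa [mul_inv_cancel_left] at this

/-- Two distinct hyperplanes that are not transverse: each of them projects to a single coordinate
at the other one, and every element has one of these two coordinates. -/
theorem coord_eq_or_coord_eq {u v : V} {j k : GraphProduct Γ G}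
    (hne : hyperplane u j ≠ hyperplane v k) (hadj : ¬ Γ.Adj u v) (y : GraphProduct Γ G) :
    coord (hyperplane u j) y = coord (hyperplane u j) k ∨
      coord (hyperplane v k) y = coord (hyperplane v k) j := by
  have key : ∀ z, coord (hyperplane u j) (j * z) = coord (hyperplane u j) k ∨
      coord (hyperplane v k) (j * z) = coord (hyperplane v k) j := by
    intro z
    induction z using right_induction with
    | one => right; rw [mul_one]
    | mul_of z w g ih =>
      rw [← mul_assoc]
      rcases ih with ih | ih
      · by_cases h : coord (hyperplane u j) (j * z * of Γ w g) = coord (hyperplane u j) (j * z)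
        · left; rw [h, ih]
        · obtain ⟨rfl, h2⟩ := coord_mul_of h
          right
          refine coord_eq_of_hyperplane_eq hne.symm hadj ?_
          exact h2.symm.trans (hyperplane_mul_of (Or.inl rfl) _ _).symm
      · by_cases h : coord (hyperplane v k) (j * z * of Γ w g) = coord (hyperplane v k) (j * z)
        · right; rw [h, ih]
        · obtain ⟨rfl, h2⟩ := coord_mul_of h
          left
          refine coord_eq_of_hyperplane_eq hne (fun h => hadj h.symm) ?_
          exact h2.symm.trans (hyperplane_mul_of (Or.inl rfl) _ _).symm
  simpa using key (j⁻¹ * y)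

end Hyperplanes

/-! ### The word metric in coordinates -/

section WordMetric

variable (S : ∀ u, Set (G u))

variable (Γ) in
/-- The union of the images of subsets of the vertex groups. -/
def generators : Set (GraphProduct Γ G) := ⋃ u, of Γ u '' S u

theorem generators_finite [Finite V] (h : ∀ u, (S u).Finite) : (generators Γ S).Finite :=
  Set.finite_iUnion fun u => (h u).image _

variable {S}

theorem closure_generators (hS : ∀ u, Subgroup.closure (S u) = ⊤) :
    Subgroup.closure (generators Γ S) = ⊤ := by
  rw [eq_top_iff, ← closure_eq_top, Subgroup.closure_le]
  rintro _ ⟨u, g, rfl⟩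
  have h : of Γ u g ∈ (Subgroup.closure (S u)).map (of Γ u) :=
    Subgroup.mem_map_of_mem _ (by rw [hS u]; trivial)
  rw [MonoidHom.map_closure] at h
  exact Subgroup.closure_mono (Set.subset_iUnion (fun u => of Γ u '' S u) u) h

theorem wordLength_of_le (hS : ∀ u, Subgroup.closure (S u) = ⊤) (u : V) (g : G u) :
    wordLength (generators Γ S) (of Γ u g) ≤ wordLength (S u) g := by
  obtain ⟨l, hl, rfl, hn⟩ := exists_word (hS u) g
  rw [← hn, map_list_prod, ← List.length_map (as := l) (of Γ u)]
  refine wordLength_le fun x hx => ?_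
  obtain ⟨y, hy, rfl⟩ := List.mem_map.1 hx
  rcases hl y hy with h | h
  · exact Or.inl (Set.mem_iUnion.2 ⟨u, y, h, rfl⟩)
  · exact Or.inr (Set.mem_iUnion.2 ⟨u, y⁻¹, h, map_inv _ _⟩)

variable (S) in
/-- The `ℓ¹` distance of the coordinates of two elements, with respect to the word metrics of the
vertex groups. -/
noncomputable def coordDist (x y : GraphProduct Γ G) : ℕ :=
  ∑ᶠ J : Hyperplane Γ G, wordLength (S J.1) ((coord J x)⁻¹ * coord J y)

variable (S) in
theorem finite_support_wordLength (x y : GraphProduct Γ G) :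
    (Function.support fun J : Hyperplane Γ G =>
      wordLength (S J.1) ((coord J x)⁻¹ * coord J y)).Finite :=
  (finite_coord_ne x y).subset fun J hJ h => hJ (by simp [h, wordLength_one])

theorem coordDist_triangle (hS : ∀ u, Subgroup.closure (S u) = ⊤) (x y z : GraphProduct Γ G) :
    coordDist S x z ≤ coordDist S x y + coordDist S y z := by
  unfold coordDist
  rw [← finsum_add_distrib (finite_support_wordLength S x y) (finite_support_wordLength S y z)]
  refine finsum_le_finsum' (finite_support_wordLength S x z)
    (((finite_support_wordLength S x y).union (finite_support_wordLength S y z)).subset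
      (Function.support_add _ _)) fun J => ?_
  have h := wordLength_mul_le (hS J.1) ((coord J x)⁻¹ * coord J y) ((coord J y)⁻¹ * coord J z)
  rwa [mul_assoc, mul_inv_cancel_left] at h

theorem coordDist_eq_add {x y z : GraphProduct Γ G}
    (h : ∀ J, coord J y = coord J x ∨ coord J y = coord J z) :
    coordDist S x z = coordDist S x y + coordDist S y z := by
  unfold coordDist
  rw [← finsum_add_distrib (finite_support_wordLength S x y) (finite_support_wordLength S y z)]
  refine finsum_congr fun J => ?_
  rcases h J with h | h <;> simp [h, wordLength_one]

theorem coordDist_mul_of (x : GraphProduct Γ G) (u : V) (s : G u) :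
    coordDist S x (x * of Γ u s) = wordLength (S u) s := by
  unfold coordDist
  rw [finsum_eq_single _ (hyperplane u x)]
  · rw [coord_hyperplane, head_of_self, inv_mul_cancel_left]
  · intro J hJ
    rw [coord_mul_of_ne s hJ, inv_mul_cancel, wordLength_one]

theorem coordDist_le_length (hS : ∀ u, Subgroup.closure (S u) = ⊤)
    {l : List (GraphProduct Γ G)} (hl : IsWordOver (generators Γ S) l) (x : GraphProduct Γ G) :
    coordDist S x (x * l.prod) ≤ l.length := by
  induction l generalizing x with
  | nil => simp [coordDist, wordLength_one]
  | cons a l ih =>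
    have ha : ∃ u, ∃ s : G u, (s ∈ S u ∨ s⁻¹ ∈ S u) ∧ of Γ u s = a := by
      rcases hl a List.mem_cons_self with h | h
      · obtain ⟨u, s, hs, rfl⟩ := Set.mem_iUnion.1 h
        exact ⟨u, s, Or.inl hs, rfl⟩
      · obtain ⟨u, s, hs, h⟩ := Set.mem_iUnion.1 h
        exact ⟨u, s⁻¹, Or.inr (by rwa [inv_inv]), by rw [map_inv, h, inv_inv]⟩
    obtain ⟨u, s, hs, rfl⟩ := ha
    have h1 := coordDist_triangle hS x (x * of Γ u s) (x * of Γ u s * l.prod)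
    have h2 := ih (fun y hy => hl y (List.mem_cons_of_mem _ hy)) (x * of Γ u s)
    have h3 : wordLength (S u) s ≤ 1 := by
      have := wordLength_le (S := S u) (l := [s]) (by simpa [IsWordOver] using hs)
      simpa using this
    rw [coordDist_mul_of] at h1
    rw [List.prod_cons, ← mul_assoc, List.length_cons]
    omega

theorem wordLength_le_coordDist (hS : ∀ u, Subgroup.closure (S u) = ⊤)
    (x y : GraphProduct Γ G) :
    wordLength (generators Γ S) (x⁻¹ * y) ≤ coordDist S x y := by
  induction hn : coordDist S x y using Nat.strong_induction_on generalizing x with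
  | _ n ih =>
    by_cases hxy : x = y
    · rw [hxy, inv_mul_cancel, wordLength_one]
      exact Nat.zero_le _
    · obtain ⟨u, hu⟩ := exists_coord_ne hxy
      obtain ⟨s, hs⟩ : ∃ s : G u, s = (coord (hyperplane u x) x)⁻¹ * coord (hyperplane u x) y :=
        ⟨_, rfl⟩
      have hpos : wordLength (S u) s ≠ 0 := fun h =>
        hu (inv_mul_eq_one.1 (hs ▸ eq_one_of_wordLength (hS u) h))
      have hadd : coordDist S x y =
          coordDist S x (x * of Γ u s) + coordDist S (x * of Γ u s) y := by
        refine coordDist_eq_add fun J => ?_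
        by_cases hJ : J = hyperplane u x
        · subst hJ
          right
          rw [coord_hyperplane, head_of_self, hs, mul_inv_cancel_left]
        · left
          exact coord_mul_of_ne s hJ
      rw [coordDist_mul_of] at hadd
      have h1 := ih _ (by omega) (x * of Γ u s) rfl
      have h2 := wordLength_mul_le (closure_generators (Γ := Γ) hS) (of Γ u s)
        ((x * of Γ u s)⁻¹ * y)
      have h3 := wordLength_of_le (Γ := Γ) hS u s
      have e : of Γ u s * ((x * of Γ u s)⁻¹ * y) = x⁻¹ * y := by group
      rw [e] at h2
      omega

/-- The word metric of the graph product is the `ℓ¹` metric of the coordinates. -/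
theorem wordLength_eq_coordDist (hS : ∀ u, Subgroup.closure (S u) = ⊤)
    (x y : GraphProduct Γ G) :
    wordLength (generators Γ S) (x⁻¹ * y) = coordDist S x y := by
  refine le_antisymm (wordLength_le_coordDist hS x y) ?_
  obtain ⟨l, hl, hp, hn⟩ := exists_word (closure_generators (Γ := Γ) hS) (x⁻¹ * y)
  have h := coordDist_le_length hS hl x
  rwa [hp, mul_inv_cancel_left, hn] at h

/-- The hyperplane coordinates on the graph product with the word metric. -/
noncomputable def hyperplaneSystem (hS : ∀ u, Subgroup.closure (S u) = ⊤) :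
    letI : MetricSpace (GraphProduct Γ G) := wordMetric _ (closure_generators hS)
    letI : ∀ J : Hyperplane Γ G, MetricSpace (G J.1) := fun J => wordMetric _ (hS J.1)
    HyperplaneSystem (GraphProduct Γ G) V (Hyperplane Γ G) (fun J => G J.1) :=
  letI : MetricSpace (GraphProduct Γ G) := wordMetric _ (closure_generators hS)
  letI : ∀ J : Hyperplane Γ G, MetricSpace (G J.1) := fun J => wordMetric _ (hS J.1)
  { coord := coord
    Adj := fun x J => hyperplane J.1 x = J
    type := Sigma.fst
    finite_ne := finite_coord_ne
    dist_eq := fun x y => by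
      have h := (Nat.castAddMonoidHom ℝ).map_finsum (finite_support_wordLength S x y)
      rw [← coordDist, ← wordLength_eq_coordDist hS] at h
      exact h
    exists_adj := by
      rintro ⟨u, q⟩
      obtain ⟨x, rfl⟩ := QuotientGroup.mk_surjective q
      exact ⟨x, rfl⟩
    exists_adj_ne := fun x y hxy => by
      obtain ⟨u, hu⟩ := exists_coord_ne hxy
      exact ⟨hyperplane u x, rfl, hu⟩
    exists_move := by
      rintro x ⟨u, q⟩ hJ a
      obtain rfl : QuotientGroup.mk x = q := eq_of_heq (Sigma.mk.inj hJ).2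
      refine ⟨x * of Γ u ((coord (hyperplane u x) x)⁻¹ * a),
        hyperplane_mul_of (Or.inl rfl) _ _, ?_, fun K hK => coord_mul_of_ne _ hK, ?_⟩
      · rw [coord_hyperplane, head_of_self, mul_inv_cancel_left]
      · rintro ⟨v, r⟩ hK
        obtain rfl : QuotientGroup.mk x = r := eq_of_heq (Sigma.mk.inj hK).2
        by_cases huv : u = v ∨ Γ.Adj v u
        · exact Or.inl (hyperplane_mul_of huv _ _)
        · rw [not_or] at huv
          have hne : hyperplane u x ≠ hyperplane v x := fun h => huv.1 (congrArg Sigma.fst h)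
          exact Or.inr ⟨hne, coord_eq_or_coord_eq hne fun h => huv.2 h.symm⟩
    sameType := by
      rintro ⟨u, q⟩ ⟨v, r⟩ hne rfl
      obtain ⟨j, rfl⟩ := QuotientGroup.mk_surjective q
      obtain ⟨k, rfl⟩ := QuotientGroup.mk_surjective r
      exact ⟨_, _, coord_eq_or_coord_eq hne (Γ.loopless.irrefl _)⟩ }

end WordMetric

end GraphProduct

theorem theorem7p4 {V : Type*} [Finite V] (Γ : SimpleGraph V) (G : V → Type*)
    [∀ u, Group (G u)] (hG : ∀ u, IsCoarseMedianGroup (G u)) :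
    IsCoarseMedianGroup (GraphProduct Γ G) := by
  choose S hfin hS μ hμ using hG
  let : ∀ u, MetricSpace (G u) := fun u => wordMetric (S u) (hS u)
  let : MetricSpace (GraphProduct Γ G) := wordMetric _ (GraphProduct.closure_generators hS)
  choose ν κ hκ hν hmaj using fun u => (hμ u).exists_exactMajority
  have := Fintype.ofFinite V
  have hdist : ∀ u (a b : G u), a ≠ b → 1 ≤ dist a b := fun u a b hab => by
    have h : wordLength (S u) (a⁻¹ * b) ≠ 0 := fun h =>
      hab (inv_mul_eq_one.1 (eq_one_of_wordLength (hS u) h))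
    exact Nat.one_le_cast.2 (Nat.one_le_iff_ne_zero.2 h)
  obtain ⟨m, hm⟩ := (GraphProduct.hyperplaneSystem (Γ := Γ) hS).exists_isCoarseMedian
    (κ := ∑ u, κ u) (Finset.sum_nonneg fun u _ => hκ u) (μ := fun J => ν J.1)
    (fun J => (hν J.1).mono (Finset.single_le_sum (fun u _ => hκ u) (Finset.mem_univ J.1)))
    (fun J => hmaj J.1) (fun J => hdist J.1)
  exact ⟨_, GraphProduct.generators_finite S hfin, GraphProduct.closure_generators hS, m, hm⟩
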